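/- Let $0\le k\le n$ be integers. Let $\mathcal K_k^n$ be the set of all nonempty closed convex sets $A\subseteq\mathbb R^n$ of dimension $k$ (that is, whose affine hull $\mathrm{Aff}(A)$ has dimension $k$), with the Attouch–Wets metric $$d_{AW}(A,B)=\sup_{j\ge 1}\min\Big\{\tfrac1j,\ \sup_{\|x\|<j}|d(x,A)-d(x,B)|\Big\},$$ and let $\mathcal K_{k,b}^n$ be the set of all bounded members of $\mathcal K_k^n$, with the Hausdorff metric. Let $\mathrm{Gr}_k(n)\subseteq\mathcal K_k^n$ be the set of all $k$-dimensional linear subspaces of $\mathbb R^n$, with the subspace topology, and for $W\in\mathrm{Gr}_k(n)$ put $\widetilde W=\{V\in\mathrm{Gr}_k(n):\pi_W(V)=W\}$, where $\pi_W$ is the orthogonal projection of $\mathbb R^n$ onto $W$. Let $\Lambda:\mathcal K_k^n\to\mathrm{Gr}_k(n)$ send $A$ to the linear subspace parallel to $\mathrm{Aff}(A)$, and let $\Gamma=\Lambda|_{\mathcal K_{k,b}^n}$. A tuple $(E,B,F,p)$ of topological spaces $E,B,F$ and a map $p:E\to B$ is called a fiber bundle if $p$ is a continuous surjection and $B$ has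 an open cover $\mathcal U$ such that for every $U\in\mathcal U$ there is a homeomorphism $\varphi_U:U\times F\to p^{-1}(U)$ with $p(\varphi_U(b,t))=b$ for all $(b,t)\in U\times F$. Then: 1. $\Lambda$ is a retraction of $\mathcal K_k^n$ onto $\mathrm{Gr}_k(n)$, i.e. $\Lambda$ is continuous and $\Lambda(W)=W$ for every $W\in\mathrm{Gr}_k(n)$. 2. For every $W\in\mathrm{Gr}_k(n)$, $\Lambda^{-1}(\widetilde W)$ is homeomorphic to $\widetilde W\times\mathbb R^{n-k}\times\mathcal K_k^k$. 3. $(\mathcal K_k^n,\ \mathrm{Gr}_k(n),\ \mathbb R^{n-k}\times\mathcal K_k^k,\ \Lambda)$ is a fiber bundle. 4. For every $W\in\mathrm{Gr}_k(n)$, $\Gamma^{-1}(\widetilde W)$ is homeomorphic to $\widetilde W\times\mathbb R^{n-k}\times\mathcal K_{k,b}^k$, and $(\mathcal K_{k,b}^n,\ \mathrm{Gr}_k(n),\ \mathbb R^{n-k}\times\mathcal K_{k,b}^k,\ \Gamma)$ is a fiber bundle. -/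

import Mathlib

namespace ConvexHyperspace

/-! ## The hyperspace of nonempty closed convex sets with the Attouch-Wets metric -/

/-- A nonempty closed convex subset of `H`; the type of these is `𝒦^H`. -/
@[ext]
structure ClosedConvexSet (H : Type*) [NormedAddCommGroup H] [InnerProductSpace ℝ H] where
  carrier : Set H
  nonempty' : carrier.Nonempty
  isClosed' : IsClosed carrier
  convex' : Convex ℝ carrier

section Metrics

variable {H : Type*} [NormedAddCommGroup H]

/-- `sup_{‖x‖ < r} |d(x, A) - d(x, B)|`. -/
noncomputable def distGap (r : ℝ) (A B : Set H) : ℝ :=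
  ⨆ x : Metric.ball (0 : H) r, |Metric.infDist (x : H) A - Metric.infDist (x : H) B|

/-- The Attouch-Wets distance `sup_{j ≥ 1} min {1/j, sup_{‖x‖ < j} |d(x, A) - d(x, B)|}`
(the integer `j ≥ 1` is written `j + 1` with `j : ℕ`). -/
noncomputable def distAW (A B : Set H) : ℝ :=
  ⨆ j : ℕ, min (1 / ((j : ℝ) + 1)) (distGap ((j : ℝ) + 1) A B)

theorem bddAbove_distGap (r : ℝ) (A B : Set H) :
    BddAbove (Set.range fun x : Metric.ball (0 : H) r =>
      |Metric.infDist (x : H) A - Metric.infDist (x : H) B|) := by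
  refine ⟨(Metric.infDist (0 : H) A + r) + (Metric.infDist (0 : H) B + r), ?_⟩
  rintro _ ⟨⟨x, hx⟩, rfl⟩
  have hx' : dist x 0 < r := hx
  have h1 : Metric.infDist x A ≤ Metric.infDist (0 : H) A + dist x 0 :=
    Metric.infDist_le_infDist_add_dist
  have h2 : Metric.infDist x B ≤ Metric.infDist (0 : H) B + dist x 0 :=
    Metric.infDist_le_infDist_add_dist
  have h3 : 0 ≤ Metric.infDist x A := Metric.infDist_nonneg
  have h4 : 0 ≤ Metric.infDist x B := Metric.infDist_nonneg
  simp only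
  rw [abs_le]
  constructor <;> linarith

theorem le_distGap {r : ℝ} (A B : Set H) {x : H} (hx : ‖x‖ < r) :
    |Metric.infDist x A - Metric.infDist x B| ≤ distGap r A B :=
  le_ciSup (bddAbove_distGap r A B) ⟨x, by simpa using hx⟩

theorem distGap_nonneg (r : ℝ) (A B : Set H) : 0 ≤ distGap r A B :=
  Real.iSup_nonneg fun _ => abs_nonneg _

theorem distGap_self (r : ℝ) (A : Set H) : distGap r A A = 0 := by
  simp [distGap]

theorem distGap_comm (r : ℝ) (A B : Set H) : distGap r A B = distGap r B A := by
  unfold distGap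
  congr 1
  funext x
  exact abs_sub_comm _ _

theorem distGap_triangle (r : ℝ) (A B C : Set H) :
    distGap r A C ≤ distGap r A B + distGap r B C := by
  refine Real.iSup_le (fun x => ?_) (add_nonneg (distGap_nonneg _ _ _) (distGap_nonneg _ _ _))
  have hx : ‖(x : H)‖ < r := mem_ball_zero_iff.1 x.2
  exact (abs_sub_le _ (Metric.infDist (x : H) B) _).trans
    (add_le_add (le_distGap A B hx) (le_distGap B C hx))

theorem bddAbove_distAW (A B : Set H) :
    BddAbove (Set.range fun j : ℕ => min (1 / ((j : ℝ) + 1)) (distGap ((j : ℝ) + 1) A B)) := by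
  refine ⟨1, ?_⟩
  rintro _ ⟨j, rfl⟩
  refine (min_le_left _ _).trans ?_
  rw [div_le_one (by positivity)]
  have : (0 : ℝ) ≤ j := Nat.cast_nonneg j
  linarith

theorem le_distAW (A B : Set H) (j : ℕ) :
    min (1 / ((j : ℝ) + 1)) (distGap ((j : ℝ) + 1) A B) ≤ distAW A B :=
  le_ciSup (bddAbove_distAW A B) j

theorem distAW_nonneg (A B : Set H) : 0 ≤ distAW A B :=
  Real.iSup_nonneg fun _ => le_min (by positivity) (distGap_nonneg _ _ _)

theorem distAW_self (A : Set H) : distAW A A = 0 := by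
  have h : ∀ j : ℕ, min (1 / ((j : ℝ) + 1)) (distGap ((j : ℝ) + 1) A A) = 0 := fun j => by
    rw [distGap_self]
    exact min_eq_right (by positivity)
  simp only [distAW, h, ciSup_const]

theorem distAW_comm (A B : Set H) : distAW A B = distAW B A := by
  simp only [distAW, distGap_comm _ A B]

theorem distAW_triangle (A B C : Set H) : distAW A C ≤ distAW A B + distAW B C := by
  refine Real.iSup_le (fun j => ?_) (add_nonneg (distAW_nonneg _ _) (distAW_nonneg _ _))
  refine le_trans ?_ (add_le_add (le_distAW A B j) (le_distAW B C j))
  have h0 : (0 : ℝ) ≤ 1 / ((j : ℝ) + 1) := by positivity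
  have h1 := distGap_nonneg ((j : ℝ) + 1) A B
  have h2 := distGap_nonneg ((j : ℝ) + 1) B C
  have h3 := distGap_triangle ((j : ℝ) + 1) A B C
  rcases le_total (1 / ((j : ℝ) + 1)) (distGap ((j : ℝ) + 1) A B) with h | h
  · rw [min_eq_left h]
    have := min_le_left (1 / ((j : ℝ) + 1)) (distGap ((j : ℝ) + 1) A C)
    have := le_min h0 h2
    linarith
  · rw [min_eq_right h]
    rcases le_total (1 / ((j : ℝ) + 1)) (distGap ((j : ℝ) + 1) B C) with h' | h'
    · rw [min_eq_left h']
      have := min_le_left (1 / ((j : ℝ) + 1)) (distGap ((j : ℝ) + 1) A C)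
      linarith
    · rw [min_eq_right h']
      have := min_le_right (1 / ((j : ℝ) + 1)) (distGap ((j : ℝ) + 1) A C)
      linarith

theorem infDist_eq_of_distAW_eq_zero {A B : Set H} (h : distAW A B = 0) (x : H) :
    Metric.infDist x A = Metric.infDist x B := by
  obtain ⟨j, hj⟩ := exists_nat_gt ‖x‖
  have h1 := le_distAW A B j
  rw [h] at h1
  have h2 : (0 : ℝ) < 1 / ((j : ℝ) + 1) := by positivity
  have h3 : distGap ((j : ℝ) + 1) A B ≤ 0 := by
    rcases min_le_iff.1 h1 with h4 | h4
    · linarith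
    · exact h4
  have h5 := (le_distGap A B (show ‖x‖ < (j : ℝ) + 1 by linarith)).trans h3
  exact sub_eq_zero.1 (abs_eq_zero.1 (le_antisymm h5 (abs_nonneg _)))

/-- `𝒦^H` carries the Attouch-Wets metric. -/
noncomputable instance [InnerProductSpace ℝ H] : MetricSpace (ClosedConvexSet H) where
  dist A B := distAW A.carrier B.carrier
  dist_self A := distAW_self A.carrier
  dist_comm A B := distAW_comm A.carrier B.carrier
  dist_triangle A B C := distAW_triangle A.carrier B.carrier C.carrier
  eq_of_dist_eq_zero := by
    intro A B h
    ext x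
    rw [A.isClosed'.mem_iff_infDist_zero A.nonempty', B.isClosed'.mem_iff_infDist_zero B.nonempty',
      infDist_eq_of_distAW_eq_zero h x]

end Metrics

/-! ## Bounded closed convex sets with the Hausdorff metric -/

/-- A nonempty bounded closed convex subset of `H`; the type of these is `𝒦_b^H`. -/
@[ext]
structure BoundedClosedConvexSet (H : Type*) [NormedAddCommGroup H] [InnerProductSpace ℝ H]
    extends ClosedConvexSet H where
  isBounded' : Bornology.IsBounded carrier

/-- `𝒦_b^H` carries the Hausdorff metric. -/
noncomputable instance {H : Type*} [NormedAddCommGroup H] [InnerProductSpace ℝ H] :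
    MetricSpace (BoundedClosedConvexSet H) where
  dist A B := Metric.hausdorffDist A.carrier B.carrier
  dist_self A := Metric.hausdorffDist_self_zero
  dist_comm A B := Metric.hausdorffDist_comm
  dist_triangle A B C := Metric.hausdorffDist_triangle
    (Metric.hausdorffEDist_ne_top_of_nonempty_of_bounded A.nonempty' B.nonempty'
      A.isBounded' B.isBounded')
  eq_of_dist_eq_zero := by
    intro A B h
    have h' : A.carrier = B.carrier :=
      (A.isClosed'.hausdorffDist_zero_iff_eq B.isClosed'
        (Metric.hausdorffEDist_ne_top_of_nonempty_of_bounded A.nonempty' B.nonempty'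
          A.isBounded' B.isBounded')).1 h
    exact BoundedClosedConvexSet.ext h'

/-! ## Convex sets of a given dimension -/

/-- The dimension of a closed convex set: that of its affine hull. -/
noncomputable def ClosedConvexSet.dim {H : Type*} [NormedAddCommGroup H] [InnerProductSpace ℝ H]
    [FiniteDimensional ℝ H] (A : ClosedConvexSet H) : ℕ :=
  Module.finrank ℝ (affineSpan ℝ A.carrier).direction

/-- `𝒦_k^H`: the `k`-dimensional closed convex sets, with the Attouch-Wets (subspace) metric. -/
abbrev ConvexDim (k : ℕ) (H : Type*) [NormedAddCommGroup H] [InnerProductSpace ℝ H]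
    [FiniteDimensional ℝ H] : Type _ :=
  {A : ClosedConvexSet H // A.dim = k}

/-- `𝒦_{k,b}^H`: the `k`-dimensional bounded closed convex sets, with the Hausdorff (subspace)
metric. -/
abbrev BoundedConvexDim (k : ℕ) (H : Type*) [NormedAddCommGroup H] [InnerProductSpace ℝ H]
    [FiniteDimensional ℝ H] : Type _ :=
  {A : BoundedClosedConvexSet H // A.toClosedConvexSet.dim = k}

/-- The inclusion of `𝒦_{k,b}^H` in `𝒦_k^H`. -/
def BoundedConvexDim.incl {k : ℕ} {H : Type*} [NormedAddCommGroup H] [InnerProductSpace ℝ H]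
    [FiniteDimensional ℝ H] (A : BoundedConvexDim k H) : ConvexDim k H :=
  ⟨A.1.toClosedConvexSet, A.2⟩

/-! ## The Grassmann manifold -/

/-- `Gr_k(H)`: the `k`-dimensional linear subspaces of `H`. -/
@[ext]
structure Gr (k : ℕ) (H : Type*) [NormedAddCommGroup H] [InnerProductSpace ℝ H]
    [FiniteDimensional ℝ H] where
  toSubmodule : Submodule ℝ H
  finrank_eq : Module.finrank ℝ toSubmodule = k

section Grassmann

variable {k : ℕ} {H : Type*} [NormedAddCommGroup H] [InnerProductSpace ℝ H]
  [FiniteDimensional ℝ H]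

/-- A `k`-dimensional linear subspace is a `k`-dimensional closed convex set. -/
def Gr.incl (W : Gr k H) : ConvexDim k H :=
  ⟨{ carrier := (W.toSubmodule : Set H)
     nonempty' := ⟨0, W.toSubmodule.zero_mem⟩
     isClosed' := W.toSubmodule.closed_of_finiteDimensional
     convex' := W.toSubmodule.convex }, by
    have h : affineSpan ℝ (W.toSubmodule : Set H) = W.toSubmodule.toAffineSubspace :=
      AffineSubspace.affineSpan_coe W.toSubmodule.toAffineSubspace
    simp only [ClosedConvexSet.dim]
    rw [h, Submodule.toAffineSubspace_direction]
    exact W.finrank_eq⟩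

/-- `Gr_k(H)` is topologized as a subspace of the hyperspace `𝒦_k^H`. -/
noncomputable instance : TopologicalSpace (Gr k H) :=
  TopologicalSpace.induced Gr.incl inferInstance

/-- `W̃ = {V ∈ Gr_k(H) : π_W(V) = W}`, with `π_W` the orthogonal projection onto `W`. -/
def Gr.nbhd (W : Gr k H) : Set (Gr k H) :=
  {V | (fun x : H => W.toSubmodule.starProjection x) '' (V.toSubmodule : Set H) =
    (W.toSubmodule : Set H)}

/-- `Λ : 𝒦_k^H → Gr_k(H)` sends `A` to the linear subspace parallel to its affine hull. -/
noncomputable def parallelMap (A : ConvexDim k H) : Gr k H :=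
  ⟨(affineSpan ℝ A.1.carrier).direction, A.2⟩

/-- `Γ : 𝒦_{k,b}^H → Gr_k(H)`, the restriction of `Λ` to `𝒦_{k,b}^H`. -/
noncomputable def parallelMapBounded (A : BoundedConvexDim k H) : Gr k H :=
  parallelMap A.incl

end Grassmann

/-! ## Retractions and fiber bundles -/

/-- `r : X → B` is a retraction, where `B` is regarded as a subspace of `X` through `i`. -/
structure IsRetraction {X B : Type*} [TopologicalSpace X] [TopologicalSpace B]
    (i : B → X) (r : X → B) : Prop where
  isEmbedding : Topology.IsEmbedding i
  continuous : Continuous r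
  leftInverse : ∀ b, r (i b) = b

/-- `(E, B, F, p)` is a fiber bundle: `p` is a continuous surjection and `B` has an open cover
over each member `U` of which there is a homeomorphism `U × F ≃ p⁻¹(U)` compatible with the
projections to `U`. -/
structure IsFiberBundle {E B : Type*} (F : Type*) [TopologicalSpace E] [TopologicalSpace B]
    [TopologicalSpace F] (p : E → B) : Prop where
  continuous : Continuous p
  surjective : Function.Surjective p
  locallyTrivial : ∃ 𝒰 : Set (Set B), (∀ U ∈ 𝒰, IsOpen U) ∧ ⋃₀ 𝒰 = Set.univ ∧
    ∀ U ∈ 𝒰, ∃ φ : (U × F) ≃ₜ (p ⁻¹' U), ∀ (b : U) (t : F), p (φ (b, t)) = b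

end ConvexHyperspace

open ConvexHyperspace

/-! Split ℝⁿ as W ⊕ W^⊥, read as P × Q with P = ℝᵏ and Q = ℝⁿ⁻ᵏ. The subspaces in W̃ are exactly the
graphs of linear maps T : P → Q, and a k-dimensional convex set with direction in W̃ is the graph of
a unique affine map w ↦ T w + c over a unique full-dimensional convex K ⊆ P. So (T, c, K)
parametrizes Λ⁻¹(W̃), T alone parametrizes W̃, and in these coordinates Λ is the projection to T.

The topological content is that `graphOver` is an open embedding. Its continuity, and that of the
component K of its inverse, come from `tendsto_image`, a Kuratowski-convergence argument along
ultrafilters. For the slope, K has an interior point: difference quotients of points of a nearby set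
A form an operator with values in Λ(A), close to the linear part of the graph map
(`exists_nearby_linearMap`). Its P-component is close to the identity, hence invertible. This gives
both openness of the image and convergence of T; then c follows from a single point.

The bounded case is a restriction of this one, because on bounded closed convex sets the Hausdorff
and Attouch–Wets topologies agree (`isEmbedding_toClosedConvexSet`). -/

namespace ConvexHyperspace

open Filter Topology Metric

/-! ### Attouch–Wets convergence through distance functions and limits of points. -/

section Convergence

variable {H : Type*} [NormedAddCommGroup H]

theorem distGap_mono {r s : ℝ} (h : r ≤ s) (A B : Set H) : distGap r A B ≤ distGap s A B :=
  Real.iSup_le (fun x => le_distGap A B ((mem_ball_zero_iff.1 x.2).trans_le h))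
    (distGap_nonneg _ _ _)

theorem distGap_le_distAW {A B : Set H} {j : ℕ} (h : distAW A B < 1 / ((j : ℝ) + 1)) :
    distGap ((j : ℝ) + 1) A B ≤ distAW A B := by
  rcases min_le_iff.1 (le_distAW A B j) with h1 | h1
  · exact absurd h (not_lt.2 h1)
  · exact h1

variable [InnerProductSpace ℝ H] {ι : Type*}

theorem dist_eq_distAW (A B : ClosedConvexSet H) : dist A B = distAW A.carrier B.carrier := rfl

theorem tendsto_distGap {l : Filter ι} {A : ι → ClosedConvexSet H} {B : ClosedConvexSet H}
    (h : Tendsto A l (𝓝 B)) (j : ℕ) :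
    Tendsto (fun i => distGap ((j : ℝ) + 1) (A i).carrier B.carrier) l (𝓝 0) := by
  have h0 : Tendsto (fun i => distAW (A i).carrier B.carrier) l (𝓝 0) :=
    tendsto_iff_dist_tendsto_zero.1 h
  have h1 : ∀ᶠ i in l, distAW (A i).carrier B.carrier < 1 / ((j : ℝ) + 1) :=
    h0.eventually_lt_const (by positivity)
  refine squeeze_zero' (Eventually.of_forall fun i => distGap_nonneg _ _ _) ?_ h0
  filter_upwards [h1] with i hi using distGap_le_distAW hi

theorem tendsto_infDist {l : Filter ι} {A : ι → ClosedConvexSet H} {B : ClosedConvexSet H}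
    (h : Tendsto A l (𝓝 B)) (x : H) :
    Tendsto (fun i => infDist x (A i).carrier) l (𝓝 (infDist x B.carrier)) := by
  obtain ⟨j, hj⟩ := exists_nat_gt ‖x‖
  rw [tendsto_iff_dist_tendsto_zero]
  refine squeeze_zero (fun _ => dist_nonneg) (fun i => ?_) (tendsto_distGap h j)
  exact le_distGap _ _ (by linarith)

/-- Distance functions are 1-Lipschitz, so convergence on a finite net of a compact ball is uniform
on that ball. -/
theorem tendsto_of_infDist [FiniteDimensional ℝ H] {l : Filter ι} {A : ι → ClosedConvexSet H}
    {B : ClosedConvexSet H}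
    (h : ∀ x, Tendsto (fun i => infDist x (A i).carrier) l (𝓝 (infDist x B.carrier))) :
    Tendsto A l (𝓝 B) := by
  rw [Metric.tendsto_nhds]
  intro ε hε
  obtain ⟨J, hJ⟩ := exists_nat_one_div_lt (half_pos hε)
  obtain ⟨t, -, htf, htc⟩ := (isCompact_closedBall (0 : H) ((J : ℝ) + 1)).finite_cover_balls
    (show 0 < ε / 8 by positivity)
  have h1 : ∀ᶠ i in l, ∀ y ∈ t, |infDist y (A i).carrier - infDist y B.carrier| < ε / 8 := by
    rw [htf.eventually_all]
    intro y _
    exact (Metric.tendsto_nhds.1 (h y)) (ε / 8) (by positivity)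
  filter_upwards [h1] with i hi
  have hgap : distGap ((J : ℝ) + 1) (A i).carrier B.carrier ≤ ε / 2 := by
    refine Real.iSup_le (fun x => ?_) (by positivity)
    have hx : (x : H) ∈ closedBall (0 : H) ((J : ℝ) + 1) := ball_subset_closedBall x.2
    obtain ⟨y, hy, hxy⟩ := Set.mem_iUnion₂.1 (htc hx)
    have h2 := hi y hy
    have h3 : dist (x : H) y < ε / 8 := hxy
    have h3' : dist y (x : H) < ε / 8 := by rwa [dist_comm]
    have h4 : infDist (x : H) (A i).carrier ≤ infDist y (A i).carrier + dist (x : H) y :=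
      infDist_le_infDist_add_dist
    have h5 : infDist (x : H) B.carrier ≤ infDist y B.carrier + dist (x : H) y :=
      infDist_le_infDist_add_dist
    have h6 : infDist y (A i).carrier ≤ infDist (x : H) (A i).carrier + dist y (x : H) :=
      infDist_le_infDist_add_dist
    have h7 : infDist y B.carrier ≤ infDist (x : H) B.carrier + dist y (x : H) :=
      infDist_le_infDist_add_dist
    rw [abs_lt] at h2
    rw [abs_le]
    constructor <;> linarith [h2.1, h2.2]
  rw [dist_eq_distAW]
  refine lt_of_le_of_lt (Real.iSup_le (fun j => ?_) (by positivity)) (half_lt_self hε)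
  -- Large radii are controlled by the truncation 1/(j + 1), small ones by the uniform estimate on
  -- the ball of radius J + 1.
  rcases le_total J j with hj | hj
  · refine (min_le_left _ _).trans (le_trans ?_ hJ.le)
    exact one_div_le_one_div_of_le (by positivity) (by exact_mod_cast Nat.succ_le_succ hj)
  · exact (min_le_right _ _).trans ((distGap_mono (by exact_mod_cast Nat.succ_le_succ hj) _ _).trans
      hgap)

/-- Points of a limit set are limits of points of the approximating sets. -/
theorem exists_tendsto_of_mem [FiniteDimensional ℝ H] {l : Filter ι} {A : ι → ClosedConvexSet H}
    {B : ClosedConvexSet H} (h : Tendsto A l (𝓝 B)) {b : H} (hb : b ∈ B.carrier) :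
    ∃ u : ι → H, (∀ i, u i ∈ (A i).carrier) ∧ Tendsto u l (𝓝 b) := by
  choose u hu hd using fun i => (A i).isClosed'.exists_infDist_eq_dist (A i).nonempty' b
  refine ⟨u, hu, ?_⟩
  rw [tendsto_iff_dist_tendsto_zero]
  have h1 := tendsto_infDist h b
  rw [infDist_zero_of_mem hb] at h1
  refine h1.congr fun i => ?_
  rw [hd i, dist_comm]

/-- Limits of points of the approximating sets lie in the limit set. -/
theorem mem_of_tendsto_of_mem {l : Filter ι} [l.NeBot] {A : ι → ClosedConvexSet H}
    {B : ClosedConvexSet H} (h : Tendsto A l (𝓝 B)) {u : ι → H} (hu : ∀ i, u i ∈ (A i).carrier)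
    {b : H} (hb : Tendsto u l (𝓝 b)) : b ∈ B.carrier := by
  rw [B.isClosed'.mem_iff_infDist_zero B.nonempty']
  refine le_antisymm ?_ infDist_nonneg
  have h1 : Tendsto (fun i => dist b (u i)) l (𝓝 0) := by
    simpa [dist_comm] using tendsto_iff_dist_tendsto_zero.1 hb
  exact le_of_tendsto_of_tendsto' (tendsto_infDist h b) h1 fun i => infDist_le_dist_of_mem (hu i)

/-- Approximating the point of B nearest to x keeps the nearest points of A i bounded. Along an
ultrafilter they therefore converge, with no passage to a subsequence; the limit lies in B and
realizes the distance from x. -/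
theorem tendsto_of_kuratowski [FiniteDimensional ℝ H] (l : Ultrafilter ι)
    {A : ι → ClosedConvexSet H} {B : ClosedConvexSet H}
    (hlow : ∀ b ∈ B.carrier, ∃ u : ι → H, (∀ i, u i ∈ (A i).carrier) ∧ Tendsto u l (𝓝 b))
    (hupp : ∀ (u : ι → H) (b : H), (∀ i, u i ∈ (A i).carrier) → Tendsto u l (𝓝 b) →
      b ∈ B.carrier) :
    Tendsto A l (𝓝 B) := by
  refine tendsto_of_infDist fun x => ?_
  obtain ⟨b, hb, hxb⟩ := B.isClosed'.exists_infDist_eq_dist B.nonempty' x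
  obtain ⟨u, hu, hub⟩ := hlow b hb
  have hdu : Tendsto (fun i => dist x (u i)) l (𝓝 (infDist x B.carrier)) := by
    rw [hxb]
    exact tendsto_const_nhds.dist hub
  choose v hv hxv using fun i => (A i).isClosed'.exists_infDist_eq_dist (A i).nonempty' x
  have hbd : ∀ᶠ i in (l : Filter ι), v i ∈ closedBall x (infDist x B.carrier + 1) := by
    filter_upwards [hdu.eventually_lt_const (lt_add_one _)] with i hi
    rw [mem_closedBall, dist_comm, ← hxv i]
    exact (infDist_le_dist_of_mem (hu i)).trans hi.le
  obtain ⟨c, -, hc⟩ := (isCompact_closedBall x (infDist x B.carrier + 1)).ultrafilter_le_nhds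
    (l.map v) (le_principal_iff.2 hbd)
  have hvc : Tendsto v l (𝓝 c) := hc
  have hcB := hupp v c hv hvc
  have hdv : Tendsto (fun i => infDist x (A i).carrier) l (𝓝 (dist x c)) := by
    simp only [hxv]
    exact tendsto_const_nhds.dist hvc
  have hle : dist x c ≤ infDist x B.carrier :=
    le_of_tendsto_of_tendsto' hdv hdu fun i => infDist_le_dist_of_mem (hu i)
  rwa [le_antisymm hle (infDist_le_dist_of_mem hcB)] at hdv

/-- Images of convergent closed convex sets converge, when the maps and left inverses of them on
the sets converge continuously. -/
theorem tendsto_image {H' : Type*} [NormedAddCommGroup H'] [InnerProductSpace ℝ H']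
    [FiniteDimensional ℝ H] [FiniteDimensional ℝ H'] {l : Filter ι}
    {A : ι → ClosedConvexSet H} {A₀ : ClosedConvexSet H} (hA : Tendsto A l (𝓝 A₀))
    {B : ι → ClosedConvexSet H'} {B₀ : ClosedConvexSet H'}
    {g : ι → H → H'} {g₀ : H → H'} {r : ι → H' → H} {r₀ : H' → H}
    (hB : ∀ i, (B i).carrier = g i '' (A i).carrier) (hB₀ : B₀.carrier = g₀ '' A₀.carrier)
    (hr : ∀ i, ∀ a ∈ (A i).carrier, r i (g i a) = a)
    (hgc : ∀ x, Tendsto (fun z : ι × H => g z.1 z.2) (l ×ˢ 𝓝 x) (𝓝 (g₀ x)))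
    (hrc : ∀ y, Tendsto (fun z : ι × H' => r z.1 z.2) (l ×ˢ 𝓝 y) (𝓝 (r₀ y))) :
    Tendsto B l (𝓝 B₀) := by
  rw [tendsto_iff_ultrafilter]
  intro U hU
  have hAU : Tendsto A U (𝓝 A₀) := hA.mono_left hU
  have hid : Tendsto (fun i : ι => i) U l := hU
  refine tendsto_of_kuratowski U ?_ ?_
  · intro b hb
    rw [hB₀] at hb
    obtain ⟨a, ha, rfl⟩ := hb
    obtain ⟨u, hu, hua⟩ := exists_tendsto_of_mem hAU ha
    refine ⟨fun i => g i (u i), fun i => ?_, (hgc a).comp (hid.prodMk hua)⟩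
    rw [hB]
    exact ⟨_, hu i, rfl⟩
  · intro u b hu hub
    -- The left inverses pull u i back into A i, so the limit r₀ b lies in A₀; that g₀ (r₀ b) = b
    -- then follows by uniqueness of limits.
    have hr' : Tendsto (fun i => r i (u i)) U (𝓝 (r₀ b)) := (hrc b).comp (hid.prodMk hub)
    have hmem : ∀ i, r i (u i) ∈ (A i).carrier ∧ g i (r i (u i)) = u i := by
      intro i
      have := hu i
      rw [hB] at this
      obtain ⟨a, ha, hau⟩ := this
      rw [← hau, hr i a ha]
      exact ⟨ha, rfl⟩
    have hmem₀ := mem_of_tendsto_of_mem hAU (fun i => (hmem i).1) hr'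
    have hlim : Tendsto (fun i => g i (r i (u i))) U (𝓝 (g₀ (r₀ b))) :=
      (hgc _).comp (hid.prodMk hr')
    simp only [fun i => (hmem i).2] at hlim
    rw [hB₀, tendsto_nhds_unique hub hlim]
    exact ⟨_, hmem₀, rfl⟩

end Convergence

/-! ### The Hausdorff and Attouch–Wets topologies on bounded convex sets. -/

section Bounded

variable {H : Type*} [NormedAddCommGroup H] [InnerProductSpace ℝ H]

theorem continuous_toClosedConvexSet :
    Continuous (BoundedClosedConvexSet.toClosedConvexSet : BoundedClosedConvexSet H → _) := by
  refine LipschitzWith.continuous (K := 1) (LipschitzWith.of_dist_le_mul fun A B => ?_)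
  rw [NNReal.coe_one, one_mul]
  change distAW A.carrier B.carrier ≤ hausdorffDist A.carrier B.carrier
  have hfin := hausdorffEDist_ne_top_of_nonempty_of_bounded A.nonempty' B.nonempty'
    A.isBounded' B.isBounded'
  refine Real.iSup_le (fun j => (min_le_right _ _).trans ?_) hausdorffDist_nonneg
  refine Real.iSup_le (fun x => ?_) hausdorffDist_nonneg
  have h1 : infDist (x : H) B.carrier ≤ infDist (x : H) A.carrier +
    hausdorffDist A.carrier B.carrier := infDist_le_infDist_add_hausdorffDist hfin
  have h2 : infDist (x : H) A.carrier ≤ infDist (x : H) B.carrier +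
    hausdorffDist B.carrier A.carrier :=
      infDist_le_infDist_add_hausdorffDist (by rwa [hausdorffEDist_comm])
  rw [hausdorffDist_comm] at h2
  rw [abs_le]
  constructor <;> linarith

/-- Connectedness prevents escape to infinity: A has a point within 1 of B, hence inside the sphere
of radius R + 1, and it cannot meet that sphere, whose points are at distance at least 1 from B. -/
theorem norm_lt_of_distGap_lt {A B : ClosedConvexSet H} {R : ℝ}
    (hB : ∀ b ∈ B.carrier, ‖b‖ ≤ R) {r : ℝ} (hr : R + 1 < r)
    (h : distGap r A.carrier B.carrier < 1) : ∀ a ∈ A.carrier, ‖a‖ < R + 1 := by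
  have hsphere : ∀ a ∈ A.carrier, ‖a‖ ≠ R + 1 := by
    intro a ha hn
    have h1 := (le_distGap A.carrier B.carrier (show ‖a‖ < r by linarith)).trans_lt h
    rw [infDist_zero_of_mem ha, zero_sub, abs_neg, abs_of_nonneg infDist_nonneg,
      infDist_lt_iff B.nonempty'] at h1
    obtain ⟨b, hb, hab⟩ := h1
    have h2 := hB b hb
    have h3 := norm_sub_norm_le a b
    rw [dist_eq_norm] at hab
    linarith
  obtain ⟨b, hb⟩ := B.nonempty'
  have hbR := hB b hb
  have h1 := (le_distGap A.carrier B.carrier (show ‖b‖ < r by linarith)).trans_lt h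
  rw [infDist_zero_of_mem hb, sub_zero, abs_of_nonneg infDist_nonneg,
    infDist_lt_iff A.nonempty'] at h1
  obtain ⟨a₀, ha₀, hba⟩ := h1
  have ha₀R : ‖a₀‖ < R + 1 := by
    have h3 := norm_sub_norm_le a₀ b
    rw [dist_comm, dist_eq_norm] at hba
    linarith
  intro a ha
  by_contra hcon
  obtain ⟨c, hc, hcn⟩ := A.convex'.isPreconnected.intermediate_value ha₀ ha
    continuous_norm.continuousOn ⟨ha₀R.le, not_lt.1 hcon⟩
  exact hsphere c hc hcn

/-- Once both sets lie in a common ball, the gap of distance functions on that ball bounds the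
Hausdorff distance: evaluate it at points of either set. -/
theorem isEmbedding_toClosedConvexSet : IsEmbedding
    (BoundedClosedConvexSet.toClosedConvexSet : BoundedClosedConvexSet H → _) := by
  refine ⟨isInducing_iff_nhds.2 fun B => le_antisymm ?_ ?_, fun A B h =>
    BoundedClosedConvexSet.ext (congrArg ClosedConvexSet.carrier h)⟩
  · exact map_le_iff_le_comap.1 continuous_toClosedConvexSet.continuousAt
  · set l := comap (BoundedClosedConvexSet.toClosedConvexSet : BoundedClosedConvexSet H → _)
      (𝓝 B.toClosedConvexSet) with hl
    have hlim : Tendsto (BoundedClosedConvexSet.toClosedConvexSet : BoundedClosedConvexSet H → _) l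
      (𝓝 B.toClosedConvexSet) := tendsto_comap
    obtain ⟨R, hR⟩ := B.isBounded'.exists_norm_le
    obtain ⟨j, hj⟩ := exists_nat_gt (R + 1)
    have hgap := tendsto_distGap hlim j
    change Tendsto id l (𝓝 B)
    rw [tendsto_iff_dist_tendsto_zero]
    refine squeeze_zero' (Eventually.of_forall fun _ => dist_nonneg) ?_ hgap
    filter_upwards [hgap.eventually_lt_const one_pos] with A hA
    have hAR := norm_lt_of_distGap_lt hR (show R + 1 < (j : ℝ) + 1 by linarith) hA
    change hausdorffDist A.carrier B.carrier ≤ _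
    refine hausdorffDist_le_of_infDist (distGap_nonneg _ _ _) (fun a ha => ?_) (fun b hb => ?_)
    · have h1 := le_distGap A.carrier B.carrier (x := a) (r := (j : ℝ) + 1)
        (by linarith [hAR a ha])
      rwa [infDist_zero_of_mem ha, zero_sub, abs_neg, abs_of_nonneg infDist_nonneg] at h1
    · have h1 := le_distGap A.carrier B.carrier (x := b) (r := (j : ℝ) + 1)
        (by linarith [hR b hb])
      rwa [infDist_zero_of_mem hb, sub_zero, abs_of_nonneg infDist_nonneg] at h1

theorem BoundedConvexDim.isEmbedding_incl {k : ℕ} [FiniteDimensional ℝ H] :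
    IsEmbedding (BoundedConvexDim.incl : BoundedConvexDim k H → ConvexDim k H) :=
  (IsEmbedding.of_comp_iff IsEmbedding.subtypeVal).1
    (isEmbedding_toClosedConvexSet.comp IsEmbedding.subtypeVal)

end Bounded

/-- A parametrization of `p⁻¹(U)` over a parametrization of `U` gives a trivialization. -/
theorem exists_trivialization {Z F E B : Type*} [TopologicalSpace Z] [TopologicalSpace F]
    [TopologicalSpace E] [TopologicalSpace B] {p : E → B} {U : Set B} {g : Z → B}
    {Φ : Z × F → E} (hg : IsEmbedding g) (hgU : Set.range g = U) (hΦ : IsEmbedding Φ)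
    (hΦU : Set.range Φ = p ⁻¹' U) (hp : ∀ z t, p (Φ (z, t)) = g z) :
    ∃ φ : (U × F) ≃ₜ (p ⁻¹' U), ∀ (b : U) (t : F), p (φ (b, t)) = b := by
  let eg : Z ≃ₜ U := hg.toHomeomorph.trans (Homeomorph.setCongr hgU)
  let eΦ : Z × F ≃ₜ (p ⁻¹' U) := hΦ.toHomeomorph.trans (Homeomorph.setCongr hΦU)
  refine ⟨(eg.symm.prodCongr (Homeomorph.refl F)).trans eΦ, fun b t => ?_⟩
  obtain ⟨z, rfl⟩ := eg.surjective b
  change p (Φ (eg.symm (eg z), t)) = g z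
  rw [eg.symm_apply_apply, hp]

theorem finrank_map_of_injective {V V' : Type*} [AddCommGroup V] [Module ℝ V] [AddCommGroup V']
    [Module ℝ V'] {f : V →ₗ[ℝ] V'} (hf : Function.Injective f) (S : Submodule ℝ V) :
    Module.finrank ℝ (S.map f) = Module.finrank ℝ S :=
  (Submodule.equivMapOfInjective f hf S).finrank_eq.symm

/-! ### Convex sets as graphs over full-dimensional convex sets. -/

section Chart

variable {H P Q : Type*}
  [NormedAddCommGroup H] [InnerProductSpace ℝ H]
  [NormedAddCommGroup P] [InnerProductSpace ℝ P]
  [NormedAddCommGroup Q] [InnerProductSpace ℝ Q]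
  {k : ℕ} (L : H ≃L[ℝ] P × Q)

/-- The affine map `w ↦ (w, T w + c)`, read in `H` through `L`. -/
noncomputable def graphMap (T : P →L[ℝ] Q) (c : Q) : P →ᵃ[ℝ] H where
  toFun w := L.symm (w, T w + c)
  linear := (L.symm : P × Q →ₗ[ℝ] H) ∘ₗ (LinearMap.id.prod (T : P →ₗ[ℝ] Q))
  map_vadd' w v := by
    change L.symm (v + w, T (v + w) + c) = L.symm (v, T v) + L.symm (w, T w + c)
    rw [← map_add, Prod.mk_add_mk, map_add T, add_assoc]

theorem graphMap_apply (T : P →L[ℝ] Q) (c : Q) (w : P) :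
    graphMap L T c w = L.symm (w, T w + c) := rfl

theorem graphMap_linear_apply (T : P →L[ℝ] Q) (c : Q) (w : P) :
    (graphMap L T c).linear w = L.symm (w, T w) := rfl

theorem fst_graphMap (T : P →L[ℝ] Q) (c : Q) (w : P) : (L (graphMap L T c w)).1 = w := by
  simp [graphMap_apply]

theorem continuous_graphMap :
    Continuous fun z : (P →L[ℝ] Q) × Q × P => graphMap L z.1 z.2.1 z.2.2 := by
  simp only [graphMap_apply]
  fun_prop

theorem tendsto_graphMap {ι : Type*} {l : Filter ι} {T : ι → P →L[ℝ] Q} {T₀ : P →L[ℝ] Q}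
    {c : ι → Q} {c₀ : Q} (hT : Tendsto T l (𝓝 T₀)) (hc : Tendsto c l (𝓝 c₀)) (x : P) :
    Tendsto (fun y : ι × P => graphMap L (T y.1) (c y.1) y.2) (l ×ˢ 𝓝 x)
      (𝓝 (graphMap L T₀ c₀ x)) := by
  have hT' : Tendsto (fun y : ι × P => T y.1) (l ×ˢ 𝓝 x) (𝓝 T₀) := hT.comp tendsto_fst
  have hc' : Tendsto (fun y : ι × P => c y.1) (l ×ˢ 𝓝 x) (𝓝 c₀) := hc.comp tendsto_fst
  have hx' : Tendsto (fun y : ι × P => y.2) (l ×ˢ 𝓝 x) (𝓝 x) := tendsto_snd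
  have hTx : Tendsto (fun y : ι × P => T y.1 y.2) (l ×ˢ 𝓝 x) (𝓝 (T₀ x)) :=
    (Continuous.tendsto (by fun_prop : Continuous fun x : (P →L[ℝ] Q) × P => x.1 x.2)
      (T₀, x)).comp (hT'.prodMk_nhds hx')
  simp only [graphMap_apply]
  exact (L.symm.continuous.tendsto _).comp (hx'.prodMk_nhds (hTx.add hc'))

theorem graphMap_linear_injective (T : P →L[ℝ] Q) (c : Q) :
    Function.Injective (graphMap L T c).linear := by
  intro v w h
  have h1 := L.symm.injective h
  exact (Prod.ext_iff.1 h1).1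

theorem graphMap_injective (T : P →L[ℝ] Q) (c : Q) : Function.Injective (graphMap L T c) :=
  Function.LeftInverse.injective (g := fun x => (L x).1) (fst_graphMap L T c)

variable [FiniteDimensional ℝ H] [FiniteDimensional ℝ P]

/-- The part of the graph of `w ↦ T w + c` over the convex set `K`. -/
noncomputable def graphOver (z : (P →L[ℝ] Q) × Q × ConvexDim k P) : ConvexDim k H :=
  ⟨{ carrier := graphMap L z.1 z.2.1 '' z.2.2.1.carrier
     nonempty' := z.2.2.1.nonempty'.image _
     isClosed' := (Function.LeftInverse.isClosedEmbedding (f := fun x => (L x).1)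
        (fst_graphMap L z.1 z.2.1) (by fun_prop)
        ((continuous_graphMap L).comp (by fun_prop : Continuous fun w => (z.1, z.2.1, w)))
        ).isClosedMap _ z.2.2.1.isClosed'
     convex' := z.2.2.1.convex'.affine_image _ }, by
    refine Eq.trans ?_ z.2.2.2
    change Module.finrank ℝ (affineSpan ℝ (graphMap L z.1 z.2.1 '' z.2.2.1.carrier)).direction = _
    rw [← AffineSubspace.map_span, AffineSubspace.map_direction]
    exact finrank_map_of_injective (graphMap_linear_injective L z.1 z.2.1) _⟩

theorem graphOver_carrier (z : (P →L[ℝ] Q) × Q × ConvexDim k P) :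
    (graphOver L z).1.carrier = graphMap L z.1 z.2.1 '' z.2.2.1.carrier := rfl

theorem tendsto_convexDim_iff {ι : Type*} {l : Filter ι} {A : ι → ConvexDim k H}
    {B : ConvexDim k H} : Tendsto A l (𝓝 B) ↔ Tendsto (fun i => (A i).1) l (𝓝 B.1) :=
  tendsto_subtype_rng

/-- All the graph maps share one continuous left inverse, the first coordinate of L, so
`tendsto_image` applies. -/
theorem continuous_graphOver : Continuous (graphOver (k := k) L) := by
  refine continuous_iff_continuousAt.2 fun z => ?_
  refine tendsto_convexDim_iff.2 ?_
  refine tendsto_image (A := fun z : (P →L[ℝ] Q) × Q × ConvexDim k P => z.2.2.1)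
    (g := fun z => graphMap L z.1 z.2.1) (r := fun _ x => (L x).1) (r₀ := fun x => (L x).1)
    (Continuous.tendsto (by fun_prop) z) (fun _ => graphOver_carrier L _) (graphOver_carrier L _)
    (fun z a _ => fst_graphMap L _ _ a) (fun x => ?_) (fun y => ?_)
  · rw [← nhds_prod_eq]
    exact Continuous.tendsto (f := fun y : ((P →L[ℝ] Q) × Q × ConvexDim k P) × P =>
      graphMap L y.1.1 y.1.2.1 y.2) ((continuous_graphMap L).comp
      (by fun_prop : Continuous fun y : ((P →L[ℝ] Q) × Q × ConvexDim k P) × P =>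
        (y.1.1, y.1.2.1, y.2))) (z, x)
  · exact (Continuous.tendsto (by fun_prop : Continuous fun x : H => (L x).1) y).comp tendsto_snd

theorem affineSpan_eq_top_of_dim (hk : Module.finrank ℝ P = k) (K : ConvexDim k P) :
    affineSpan ℝ K.1.carrier = ⊤ := by
  rw [← AffineSubspace.direction_eq_top_iff_of_nonempty (K.1.nonempty'.affineSpan (k := ℝ))]
  exact Submodule.eq_top_of_finrank_eq (K.2.trans hk.symm)

/-- The linear subspace `{(w, T w)}`, read in `H` through `L`. -/
noncomputable def graphSubspace (hk : Module.finrank ℝ P = k) (T : P →L[ℝ] Q) : Gr k H :=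
  ⟨LinearMap.range (graphMap L T 0).linear, by
    rw [LinearMap.finrank_range_of_inj (graphMap_linear_injective L T 0), hk]⟩

omit [FiniteDimensional ℝ P] in
theorem mem_graphSubspace {hk : Module.finrank ℝ P = k} {T : P →L[ℝ] Q} {x : H} :
    x ∈ (graphSubspace L hk T).toSubmodule ↔ (L x).2 = T (L x).1 := by
  constructor
  · rintro ⟨w, rfl⟩
    simp [graphMap_linear_apply]
  · intro h
    refine ⟨(L x).1, ?_⟩
    rw [graphMap_linear_apply, ← h]
    simp

theorem parallelMap_graphOver (hk : Module.finrank ℝ P = k)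
    (z : (P →L[ℝ] Q) × Q × ConvexDim k P) :
    parallelMap (graphOver L z) = graphSubspace L hk z.1 := by
  ext1
  change (affineSpan ℝ (graphMap L z.1 z.2.1 '' z.2.2.1.carrier)).direction = _
  rw [← AffineSubspace.map_span, AffineSubspace.map_direction, affineSpan_eq_top_of_dim hk,
    AffineSubspace.direction_top, Submodule.map_top]
  rfl

omit [FiniteDimensional ℝ P] in
theorem graphSubspace_injective (hk : Module.finrank ℝ P = k) :
    Function.Injective (graphSubspace L hk) := by
  intro S T h
  ext w
  have h1 : L.symm (w, S w) ∈ (graphSubspace L hk T).toSubmodule := by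
    rw [← h, mem_graphSubspace]
    simp
  simpa [mem_graphSubspace] using h1

/-- The direction determines the slope, one point then determines the offset, and injectivity of the
graph map determines the base. -/
theorem graphOver_injective (hk : Module.finrank ℝ P = k) :
    Function.Injective (graphOver (k := k) L) := by
  rintro ⟨S, c, K⟩ ⟨T, d, M⟩ h
  have hST : S = T := graphSubspace_injective L hk <| by
    rw [← parallelMap_graphOver L hk (S, c, K), h, parallelMap_graphOver]
  subst hST
  have hc : graphMap L S c '' K.1.carrier = graphMap L S d '' M.1.carrier :=
    congrArg (fun A : ConvexDim k H => A.1.carrier) h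
  obtain ⟨w, hw⟩ := K.1.nonempty'
  obtain ⟨v, hv, hvw⟩ : graphMap L S c w ∈ graphMap L S d '' M.1.carrier :=
    hc ▸ Set.mem_image_of_mem _ hw
  have h1 := L.symm.injective hvw
  simp only [Prod.mk.injEq] at h1
  obtain ⟨rfl, h2⟩ := h1
  have hcd : c = d := (add_left_cancel h2).symm
  subst hcd
  have hKM : K = M := by
    refine Subtype.ext (ClosedConvexSet.ext ?_)
    exact (graphMap_injective L S c).image_injective hc
  rw [hKM]

/-- The `k`-dimensional subspaces that `L` and the first projection map onto `P`. -/
def graphNbhd (k : ℕ) : Set (Gr k H) :=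
  {V | ∀ w : P, ∃ x ∈ V.toSubmodule, (L x).1 = w}

/-- By equality of dimensions the surjection V → P is bijective; T is its inverse followed by the
Q-coordinate. -/
theorem exists_graphSubspace_eq (hk : Module.finrank ℝ P = k) {V : Gr k H}
    (hV : V ∈ graphNbhd L k) : ∃ T, graphSubspace L hk T = V := by
  let p : V.toSubmodule →ₗ[ℝ] P :=
    LinearMap.fst ℝ P Q ∘ₗ (L : H →ₗ[ℝ] P × Q) ∘ₗ V.toSubmodule.subtype
  have hp : Function.Surjective p := fun w => by
    obtain ⟨x, hx, hw⟩ := hV w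
    exact ⟨⟨x, hx⟩, hw⟩
  have hp' : Function.Injective p :=
    (LinearMap.injective_iff_surjective_of_finrank_eq_finrank (V.finrank_eq.trans hk.symm)).2 hp
  let e := LinearEquiv.ofBijective p ⟨hp', hp⟩
  let T : P →ₗ[ℝ] Q :=
    LinearMap.snd ℝ P Q ∘ₗ (L : H →ₗ[ℝ] P × Q) ∘ₗ V.toSubmodule.subtype ∘ₗ e.symm.toLinearMap
  refine ⟨LinearMap.toContinuousLinearMap T, ?_⟩
  ext1
  refine (Submodule.eq_of_le_of_finrank_eq (fun x hx => ?_) ?_).symm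
  · rw [mem_graphSubspace]
    have h1 : e.symm (L x).1 = ⟨x, hx⟩ := by
      rw [LinearEquiv.symm_apply_eq]
      rfl
    change (L x).2 = (L (e.symm (L x).1 : H)).2
    rw [h1]
  · rw [V.finrank_eq, (graphSubspace L hk _).finrank_eq]

theorem range_graphSubspace (hk : Module.finrank ℝ P = k) :
    Set.range (graphSubspace L hk) = graphNbhd L k := by
  refine Set.Subset.antisymm ?_ fun V hV => exists_graphSubspace_eq L hk hV
  rintro _ ⟨T, rfl⟩ w
  exact ⟨L.symm (w, T w), by simp [mem_graphSubspace], by simp⟩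

theorem range_graphOver (hk : Module.finrank ℝ P = k) :
    Set.range (graphOver (k := k) L) = parallelMap ⁻¹' graphNbhd L k := by
  refine Set.Subset.antisymm ?_ fun A hA => ?_
  · rintro _ ⟨z, rfl⟩
    rw [Set.mem_preimage, parallelMap_graphOver L hk, ← range_graphSubspace L hk]
    exact ⟨_, rfl⟩
  · obtain ⟨T, hT⟩ := exists_graphSubspace_eq L hk hA
    obtain ⟨a, ha⟩ := A.1.nonempty'
    -- The offset is forced by requiring the graph to pass through a; the rest of A lies in a + V,
    -- hence on the same graph.
    set c : Q := (L a).2 - T (L a).1 with hc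
    have key : ∀ x ∈ A.1.carrier, graphMap L T c (L x).1 = x := by
      intro x hx
      have h1 : x - a ∈ (graphSubspace L hk T).toSubmodule := by
        rw [hT]
        exact AffineSubspace.vsub_mem_direction (subset_affineSpan ℝ _ hx)
          (subset_affineSpan ℝ _ ha)
      rw [mem_graphSubspace] at h1
      simp only [map_sub, Prod.fst_sub, Prod.snd_sub] at h1
      rw [graphMap_apply, L.symm_apply_eq]
      refine Prod.ext rfl ?_
      change T (L x).1 + c = (L x).2
      rw [hc, ← sub_eq_zero]
      rw [← sub_eq_zero] at h1
      rw [← neg_eq_zero, ← h1]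
      abel
    let f := graphMap L T c
    have hfc : Continuous f :=
      (continuous_graphMap L).comp (by fun_prop : Continuous fun w => (T, c, w))
    have hKA : f '' (f ⁻¹' A.1.carrier) = A.1.carrier :=
      Set.image_preimage_eq_of_subset fun x hx => ⟨_, key x hx⟩
    let K : ClosedConvexSet P :=
      { carrier := f ⁻¹' A.1.carrier
        nonempty' := ⟨(L a).1, by rw [Set.mem_preimage, key a ha]; exact ha⟩
        isClosed' := A.1.isClosed'.preimage hfc
        convex' := A.1.convex'.affine_preimage f }
    have hK : K.dim = k := by
      rw [← A.2]
      simp only [ClosedConvexSet.dim]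
      conv_rhs => rw [← hKA, ← AffineSubspace.map_span, AffineSubspace.map_direction]
      exact (finrank_map_of_injective (graphMap_linear_injective L T c) _).symm
    exact ⟨(T, c, ⟨K, hK⟩), Subtype.ext (ClosedConvexSet.ext hKA)⟩

/-! ### Recovering the direction from nearby sets. -/

theorem exists_nearby_linearMap (hk : Module.finrank ℝ P = k)
    (z : (P →L[ℝ] Q) × Q × ConvexDim k P) :
    ∃ (C : ConvexDim k H → P →L[ℝ] H) (a : ConvexDim k H → H) (w : P),
      Tendsto C (𝓝 (graphOver L z))
        (𝓝 (LinearMap.toContinuousLinearMap (graphMap L z.1 z.2.1).linear)) ∧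
      (∀ A v, C A v ∈ (parallelMap A).toSubmodule) ∧
      Tendsto a (𝓝 (graphOver L z)) (𝓝 (graphMap L z.1 z.2.1 w)) ∧
      ∀ A, a A ∈ A.1.carrier := by
  obtain ⟨w, hw⟩ := (z.2.2.1.convex'.interior_nonempty_iff_affineSpan_eq_top).2
    (affineSpan_eq_top_of_dim hk z.2.2)
  let b := Module.finBasis ℝ P
  -- A small simplex at the interior point w: its vertices stay in K, so their images on the graph
  -- are limits of points of nearby sets.
  have hev : ∀ᶠ δ : ℝ in 𝓝[>] 0, ∀ i, w + δ • b i ∈ z.2.2.1.carrier := by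
    rw [eventually_all]
    intro i
    have h1 : Tendsto (fun δ : ℝ => w + δ • b i) (𝓝[>] 0) (𝓝 w) := by
      have : Continuous fun δ : ℝ => w + δ • b i := by fun_prop
      simpa using (this.tendsto 0).mono_left nhdsWithin_le_nhds
    exact h1 (mem_interior_iff_mem_nhds.1 hw)
  obtain ⟨δ, hδ, hδ0⟩ := (hev.and self_mem_nhdsWithin).exists
  have hδ0 : (0 : ℝ) < δ := hδ0
  have hid : Tendsto (fun A : ConvexDim k H => A.1) (𝓝 (graphOver L z)) (𝓝 (graphOver L z).1) :=
    continuous_subtype_val.continuousAt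
  obtain ⟨a, ha, hat⟩ := exists_tendsto_of_mem hid
    (Set.mem_image_of_mem (graphMap L z.1 z.2.1) (interior_subset hw))
  choose u hu hut using fun i => exists_tendsto_of_mem hid
    (Set.mem_image_of_mem (graphMap L z.1 z.2.1) (hδ i))
  -- F turns values on the basis into an operator; in finite dimension it is continuous, so
  -- convergence on the basis gives norm convergence.
  let F : (Fin (Module.finrank ℝ P) → H) →ₗ[ℝ] (P →L[ℝ] H) :=
    (LinearMap.toContinuousLinearMap : (P →ₗ[ℝ] H) ≃ₗ[ℝ] _).toLinearMap ∘ₗ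
      (b.constr ℝ).toLinearMap
  have hF : Continuous F := F.continuous_of_finiteDimensional
  have hFb : ∀ v i, F v (b i) = v i := fun v i => b.constr_basis ℝ v i
  refine ⟨fun A => F fun i => δ⁻¹ • (u i A - a A), a, w, ?_, fun A v => ?_, hat, ha⟩
  · have h1 : LinearMap.toContinuousLinearMap (graphMap L z.1 z.2.1).linear =
        F fun i => δ⁻¹ • (graphMap L z.1 z.2.1 (w + δ • b i) - graphMap L z.1 z.2.1 w) := by
      refine ContinuousLinearMap.coe_inj.1 (b.ext fun i => ?_)
      change (graphMap L z.1 z.2.1).linear (b i) = F _ (b i)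
      rw [hFb, ← vsub_eq_sub, ← AffineMap.linearMap_vsub, vsub_eq_sub, add_sub_cancel_left,
        map_smul, inv_smul_smul₀ hδ0.ne']
    rw [h1]
    refine (hF.tendsto _).comp (tendsto_pi_nhds.2 fun i => ?_)
    exact ((hut i).sub hat).const_smul _
  · change b.constr ℝ _ v ∈ _
    rw [Module.Basis.constr_apply_fintype]
    refine Submodule.sum_mem _ fun i _ => Submodule.smul_mem _ _ (Submodule.smul_mem _ _ ?_)
    exact AffineSubspace.vsub_mem_direction (subset_affineSpan ℝ _ (hu i A))
      (subset_affineSpan ℝ _ (ha A))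

omit [FiniteDimensional ℝ H] in
theorem tendsto_fst_comp {ι : Type*} {l : Filter ι} {C : ι → P →L[ℝ] H} {T : P →L[ℝ] Q} {c : Q}
    (hC : Tendsto C l (𝓝 (LinearMap.toContinuousLinearMap (graphMap L T c).linear))) :
    Tendsto (fun i => (ContinuousLinearMap.fst ℝ P Q ∘L (L : H →L[ℝ] P × Q)) ∘L C i) l (𝓝 1) := by
  have h1 : (1 : P →L[ℝ] P) = (ContinuousLinearMap.fst ℝ P Q ∘L (L : H →L[ℝ] P × Q)) ∘L
      LinearMap.toContinuousLinearMap (graphMap L T c).linear := by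
    ext w
    simp [graphMap_linear_apply]
  rw [h1]
  exact (Continuous.tendsto (by fun_prop : Continuous fun C : P →L[ℝ] H =>
    (ContinuousLinearMap.fst ℝ P Q ∘L (L : H →L[ℝ] P × Q)) ∘L C) _).comp hC

/-- For A near the given set, the P-component of the operator C A is near 1, hence a unit, hence
onto; as C A takes values in Λ(A), so is the projection of Λ(A) to P. -/
theorem isOpen_preimage_graphNbhd (hk : Module.finrank ℝ P = k) :
    IsOpen ((parallelMap : ConvexDim k H → Gr k H) ⁻¹' graphNbhd L k) := by
  rw [isOpen_iff_mem_nhds]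
  intro A hA
  rw [← range_graphOver L hk] at hA
  obtain ⟨z, rfl⟩ := hA
  obtain ⟨C, a, w, hC, hCm, -, -⟩ := exists_nearby_linearMap L hk z
  filter_upwards [tendsto_fst_comp L hC (Units.isOpen.mem_nhds isUnit_one)] with A hA v
  obtain ⟨g, hg⟩ := hA
  refine ⟨C A ((↑g⁻¹ : P →L[ℝ] P) v), hCm _ _, ?_⟩
  have h1 : ((g : P →L[ℝ] P) * (↑g⁻¹ : P →L[ℝ] P)) v = v := by
    rw [g.mul_inv]
    rfl
  rw [hg] at h1
  exact h1

/-! ### Continuity of slope, offset and base in the graph. -/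

section Inverse

variable {l : Filter ((P →L[ℝ] Q) × Q × ConvexDim k P)}
  {z : (P →L[ℝ] Q) × Q × ConvexDim k P}

/-- The approximating operators take values in the graph of the slope y.1, so their components
satisfy M y = y.1 ∘ B y. Since B y → 1, the slope is eventually M y ∘ (B y)⁻¹, which converges. -/
theorem tendsto_slope (hk : Module.finrank ℝ P = k)
    (hlim : Tendsto (graphOver L) l (𝓝 (graphOver L z))) :
    Tendsto (fun y => y.1) l (𝓝 z.1) := by
  obtain ⟨C, -, -, hC, hCm, -, -⟩ := exists_nearby_linearMap L hk z
  have hC' := hC.comp hlim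
  have hB := tendsto_fst_comp L hC'
  let M := fun y : (P →L[ℝ] Q) × Q × ConvexDim k P =>
    (ContinuousLinearMap.snd ℝ P Q ∘L (L : H →L[ℝ] P × Q)) ∘L C (graphOver L y)
  have hM : Tendsto M l (𝓝 z.1) := by
    have h1 : z.1 = (ContinuousLinearMap.snd ℝ P Q ∘L (L : H →L[ℝ] P × Q)) ∘L
        LinearMap.toContinuousLinearMap (graphMap L z.1 z.2.1).linear := by
      ext w
      simp [graphMap_linear_apply]
    rw [h1]
    exact (Continuous.tendsto (by fun_prop : Continuous fun C : P →L[ℝ] H =>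
      (ContinuousLinearMap.snd ℝ P Q ∘L (L : H →L[ℝ] P × Q)) ∘L C) _).comp hC'
  generalize hBdef : (fun y => (ContinuousLinearMap.fst ℝ P Q ∘L (L : H →L[ℝ] P × Q)) ∘L
    (C ∘ graphOver L) y) = B at hB
  have hBM : ∀ y, M y = y.1 ∘L B y := fun y => by
    rw [← hBdef]
    ext v
    have h1 := hCm (graphOver L y) v
    rw [parallelMap_graphOver L hk, mem_graphSubspace] at h1
    exact h1
  have hinv : Tendsto (fun y => Ring.inverse (B y)) l (𝓝 1) := by
    have h1 := (NormedRing.inverse_continuousAt (1 : (P →L[ℝ] P)ˣ)).tendsto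
    rw [Units.val_one, Ring.inverse_one] at h1
    exact h1.comp hB
  have hlimT : Tendsto (fun y => M y ∘L Ring.inverse (B y)) l (𝓝 (z.1 ∘L 1)) :=
    (Continuous.tendsto (by fun_prop :
      Continuous fun x : (P →L[ℝ] Q) × (P →L[ℝ] P) => x.1 ∘L x.2) (z.1, 1)).comp
      (hM.prodMk_nhds hinv)
  -- `Ring.inverse` is a true inverse only at units, so the two sides agree only eventually.
  refine hlimT.congr' ?_
  filter_upwards [hB (Units.isOpen.mem_nhds isUnit_one)] with y hy
  rw [hBM, ContinuousLinearMap.comp_assoc]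
  have h3 : B y ∘L Ring.inverse (B y) = 1 := Ring.mul_inverse_cancel (B y) hy
  rw [h3]
  rfl

theorem tendsto_offset (hk : Module.finrank ℝ P = k)
    (hlim : Tendsto (graphOver L) l (𝓝 (graphOver L z))) :
    Tendsto (fun y => y.2.1) l (𝓝 z.2.1) := by
  obtain ⟨-, a, w, -, -, ha, ham⟩ := exists_nearby_linearMap L hk z
  have hLa : Tendsto (fun y => L (a (graphOver L y))) l (𝓝 (w, z.1 w + z.2.1)) := by
    have h1 := (L.continuous.tendsto _).comp (ha.comp hlim)
    rwa [graphMap_apply, L.apply_symm_apply] at h1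
  have hTa : Tendsto (fun y => y.1 (L (a (graphOver L y))).1) l (𝓝 (z.1 w)) :=
    (Continuous.tendsto (by fun_prop : Continuous fun x : (P →L[ℝ] Q) × P => x.1 x.2)
      (z.1, w)).comp ((tendsto_slope L hk hlim).prodMk_nhds hLa.fst_nhds)
  have h2 := hLa.snd_nhds.sub hTa
  rw [add_sub_cancel_left] at h2
  refine h2.congr fun y => ?_
  obtain ⟨v, -, hv⟩ := ham (graphOver L y)
  rw [← hv, graphMap_apply]
  simp

/-- The base is the first-coordinate image of the graph. Here `tendsto_image` is used with the roles
reversed: the graph maps are the left inverses, and they converge because slope and offset do. -/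
theorem tendsto_base (hk : Module.finrank ℝ P = k)
    (hlim : Tendsto (graphOver L) l (𝓝 (graphOver L z))) :
    Tendsto (fun y => y.2.2) l (𝓝 z.2.2) := by
  refine tendsto_convexDim_iff.2 ?_
  have himage : ∀ y : (P →L[ℝ] Q) × Q × ConvexDim k P,
      y.2.2.1.carrier = (fun x => (L x).1) '' (graphOver L y).1.carrier := fun y => by
    rw [graphOver_carrier, Set.image_image]
    simp only [fst_graphMap, Set.image_id']
  have hgraph := tendsto_graphMap L (tendsto_slope L hk hlim) (tendsto_offset L hk hlim)
  refine tendsto_image (g₀ := fun x => (L x).1) (g := fun _ x => (L x).1)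
    (r := fun y => graphMap L y.1 y.2.1) (r₀ := graphMap L z.1 z.2.1)
    (tendsto_convexDim_iff.1 hlim) himage (himage z) ?_ (fun x => ?_)
    hgraph
  · rintro y _ ⟨v, -, rfl⟩
    rw [fst_graphMap]
  · exact (Continuous.tendsto (by fun_prop : Continuous fun x : H => (L x).1) x).comp
      tendsto_snd

end Inverse

theorem isEmbedding_graphOver (hk : Module.finrank ℝ P = k) :
    IsEmbedding (graphOver (k := k) L) := by
  refine ⟨isInducing_iff_nhds.2 fun z => le_antisymm
    (map_le_iff_le_comap.1 (continuous_graphOver L).continuousAt) ?_, graphOver_injective L hk⟩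
  exact (tendsto_slope L hk tendsto_comap).prodMk_nhds
    ((tendsto_offset L hk tendsto_comap).prodMk_nhds (tendsto_base L hk tendsto_comap))

theorem isOpenEmbedding_graphOver (hk : Module.finrank ℝ P = k) :
    IsOpenEmbedding (graphOver (k := k) L) :=
  ⟨isEmbedding_graphOver L hk, by
    rw [range_graphOver L hk]
    exact isOpen_preimage_graphNbhd L hk⟩

/-! ### The Grassmannian in the chart, and trivializations. -/

theorem Gr.isInducing_incl : IsInducing (Gr.incl : Gr k H → ConvexDim k H) := ⟨rfl⟩

theorem parallelMap_incl (V : Gr k H) : parallelMap V.incl = V := by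
  ext1
  change (affineSpan ℝ (V.toSubmodule : Set H)).direction = _
  have h : affineSpan ℝ (V.toSubmodule : Set H) = V.toSubmodule.toAffineSubspace :=
    AffineSubspace.affineSpan_coe V.toSubmodule.toAffineSubspace
  rw [h, Submodule.toAffineSubspace_direction]

/-- The whole space as a closed convex set of full dimension. -/
def ConvexDim.univ (hk : Module.finrank ℝ P = k) : ConvexDim k P :=
  ⟨⟨Set.univ, Set.univ_nonempty, isClosed_univ, convex_univ⟩, by
    simp only [ClosedConvexSet.dim]
    rw [AffineSubspace.span_univ, AffineSubspace.direction_top, finrank_top, hk]⟩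

theorem incl_graphSubspace (hk : Module.finrank ℝ P = k) (T : P →L[ℝ] Q) :
    (graphSubspace L hk T).incl = graphOver L (T, 0, ConvexDim.univ hk) := by
  refine Subtype.ext (ClosedConvexSet.ext ?_)
  change (LinearMap.range (graphMap L T 0).linear : Set H) = graphMap L T 0 '' Set.univ
  rw [Set.image_univ, LinearMap.coe_range]
  congr 1
  ext w
  simp [graphMap_linear_apply, graphMap_apply]

/-- A subspace is the graph with offset 0 over all of P, so this is the restriction of `graphOver`
to a slice. -/
theorem isEmbedding_graphSubspace (hk : Module.finrank ℝ P = k) :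
    IsEmbedding (graphSubspace (k := k) L hk) := by
  refine ⟨?_, graphSubspace_injective L hk⟩
  rw [← Gr.isInducing_incl.of_comp_iff]
  have h1 : Gr.incl ∘ graphSubspace L hk =
      graphOver L ∘ fun T => (T, 0, ConvexDim.univ hk) := funext (incl_graphSubspace L hk)
  rw [h1, (isEmbedding_graphOver L hk).isInducing.of_comp_iff]
  exact isEmbedding_prodMkLeft _ |>.isInducing

/-- Λ restricts to the identity on subspaces, so intersecting the open set Λ⁻¹(U) with the
Grassmannian returns U; continuity of Λ is not needed. -/
theorem isOpen_graphNbhd (hk : Module.finrank ℝ P = k) : IsOpen (graphNbhd L k) := by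
  have h1 := (isOpen_preimage_graphNbhd L hk).preimage Gr.isInducing_incl.continuous
  rw [← Set.preimage_comp] at h1
  have h2 : (parallelMap ∘ Gr.incl : Gr k H → Gr k H) = id := funext parallelMap_incl
  rwa [h2, Set.preimage_id] at h1

/-- Continuity may be tested through the open embedding `graphOver`, where Λ becomes the projection
to the slope. -/
theorem continuousAt_parallelMap (hk : Module.finrank ℝ P = k) {A : ConvexDim k H}
    (hA : parallelMap A ∈ graphNbhd L k) : ContinuousAt parallelMap A := by
  rw [← Set.mem_preimage, ← range_graphOver L hk] at hA
  obtain ⟨z, rfl⟩ := hA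
  rw [← (isOpenEmbedding_graphOver L hk).continuousAt_iff]
  have h1 : parallelMap ∘ graphOver L = fun z : (P →L[ℝ] Q) × Q × ConvexDim k P =>
    graphSubspace L hk z.1 := funext (parallelMap_graphOver L hk)
  rw [h1]
  exact ((isEmbedding_graphSubspace L hk).continuous.comp continuous_fst).continuousAt

theorem exists_trivialization_parallelMap (hk : Module.finrank ℝ P = k) :
    ∃ φ : (graphNbhd L k × Q × ConvexDim k P) ≃ₜ
      ((parallelMap : ConvexDim k H → Gr k H) ⁻¹' graphNbhd L k),
      ∀ b t, parallelMap (φ (b, t)).1 = b :=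
  exists_trivialization (isEmbedding_graphSubspace L hk) (range_graphSubspace L hk)
    (isEmbedding_graphOver L hk) (range_graphOver L hk)
    fun _ _ => parallelMap_graphOver L hk _

/-- The part of the graph of `w ↦ T w + c` over the bounded convex set `K`. -/
noncomputable def boundedGraphOver (z : (P →L[ℝ] Q) × Q × BoundedConvexDim k P) :
    BoundedConvexDim k H :=
  ⟨{ (graphOver L (z.1, z.2.1, z.2.2.incl)).1 with
     isBounded' := by
      have hK : IsCompact z.2.2.1.carrier :=
        Metric.isCompact_of_isClosed_isBounded z.2.2.1.isClosed' z.2.2.1.isBounded'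
      exact (hK.image ((continuous_graphMap L).comp
        (by fun_prop : Continuous fun w => (z.1, z.2.1, w)))).isBounded },
    (graphOver L (z.1, z.2.1, z.2.2.incl)).2⟩

theorem parallelMapBounded_boundedGraphOver (hk : Module.finrank ℝ P = k)
    (z : (P →L[ℝ] Q) × Q × BoundedConvexDim k P) :
    parallelMapBounded (boundedGraphOver L z) = graphSubspace L hk z.1 :=
  parallelMap_graphOver L hk _

theorem isEmbedding_boundedGraphOver (hk : Module.finrank ℝ P = k) :
    IsEmbedding (boundedGraphOver (k := k) L) := by
  rw [← IsEmbedding.of_comp_iff BoundedConvexDim.isEmbedding_incl]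
  exact (isEmbedding_graphOver L hk).comp
    (IsEmbedding.id.prodMap (IsEmbedding.id.prodMap BoundedConvexDim.isEmbedding_incl))

theorem range_boundedGraphOver (hk : Module.finrank ℝ P = k) :
    Set.range (boundedGraphOver (k := k) L) = parallelMapBounded ⁻¹' graphNbhd L k := by
  refine Set.Subset.antisymm ?_ fun A hA => ?_
  · rintro _ ⟨z, rfl⟩
    rw [Set.mem_preimage, parallelMapBounded_boundedGraphOver L hk, ← range_graphSubspace L hk]
    exact ⟨_, rfl⟩
  · obtain ⟨⟨T, c, K⟩, hz⟩ : A.incl ∈ Set.range (graphOver (k := k) L) := by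
      rw [range_graphOver L hk]
      exact hA
    have hcar : graphMap L T c '' K.1.carrier = A.1.carrier :=
      congrArg (fun A : ConvexDim k H => A.1.carrier) hz
    have hK : Bornology.IsBounded K.1.carrier := by
      have hA : IsCompact A.1.carrier :=
        Metric.isCompact_of_isClosed_isBounded A.1.isClosed' A.1.isBounded'
      have h1 := (hA.image (by fun_prop : Continuous fun x : H => (L x).1)).isBounded
      rw [← hcar, Set.image_image] at h1
      simpa only [fst_graphMap, Set.image_id'] using h1
    refine ⟨(T, c, ⟨⟨K.1, hK⟩, K.2⟩), ?_⟩
    exact BoundedConvexDim.isEmbedding_incl.injective hz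

theorem exists_trivialization_parallelMapBounded (hk : Module.finrank ℝ P = k) :
    ∃ φ : (graphNbhd L k × Q × BoundedConvexDim k P) ≃ₜ
      ((parallelMapBounded : BoundedConvexDim k H → Gr k H) ⁻¹' graphNbhd L k),
      ∀ b t, parallelMapBounded (φ (b, t)).1 = b :=
  exists_trivialization (isEmbedding_graphSubspace L hk) (range_graphSubspace L hk)
    (isEmbedding_boundedGraphOver L hk) (range_boundedGraphOver L hk)
    fun _ _ => parallelMapBounded_boundedGraphOver L hk _

/-- The closed unit ball as a bounded convex set of full dimension. -/
noncomputable def BoundedConvexDim.unitBall (hk : Module.finrank ℝ P = k) :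
    BoundedConvexDim k P :=
  ⟨⟨⟨closedBall 0 1, nonempty_closedBall.2 zero_le_one, isClosed_closedBall,
      convex_closedBall 0 1⟩, isBounded_closedBall⟩, by
    have h1 : (interior (closedBall (0 : P) 1)).Nonempty :=
      ⟨0, ball_subset_interior_closedBall (mem_ball_self one_pos)⟩
    rw [(convex_closedBall (0 : P) 1).interior_nonempty_iff_affineSpan_eq_top] at h1
    change Module.finrank ℝ (affineSpan ℝ (closedBall (0 : P) 1)).direction = k
    rw [h1, AffineSubspace.direction_top, finrank_top, hk]⟩

/-- For k > 0 a subspace is unbounded and is no preimage of itself under Γ; its part over the unit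
ball is used instead. -/
theorem exists_parallelMapBounded_eq (hk : Module.finrank ℝ P = k) {V : Gr k H}
    (hV : V ∈ graphNbhd L k) : ∃ A, parallelMapBounded A = V := by
  obtain ⟨T, rfl⟩ := exists_graphSubspace_eq L hk hV
  exact ⟨boundedGraphOver L (T, 0, BoundedConvexDim.unitBall hk),
    parallelMapBounded_boundedGraphOver L hk _⟩

end Chart

/-! ### Charts adapted to the sets W̃, and the theorem. -/

theorem Gr.mem_nbhd_self {H : Type*} [NormedAddCommGroup H] [InnerProductSpace ℝ H]
    [FiniteDimensional ℝ H] {k : ℕ} (W : Gr k H) : W ∈ W.nbhd := by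
  refine Set.Subset.antisymm ?_ fun x hx => ⟨x, hx, ?_⟩
  · rintro _ ⟨x, -, rfl⟩
    exact Submodule.starProjection_apply_mem _ _
  · exact Submodule.starProjection_eq_self_iff.2 hx

/-- With L built from W ⊕ W^⊥, its first coordinate is π_W up to an isomorphism W ≃ ℝᵏ, so mapping V
onto P means π_W(V) = W. The identifications need only be linear, since only topology is at stake.
-/
theorem Gr.exists_chart {n k : ℕ} (hk : k ≤ n) (W : Gr k (EuclideanSpace ℝ (Fin n))) :
    ∃ L : EuclideanSpace ℝ (Fin n) ≃L[ℝ]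
        EuclideanSpace ℝ (Fin k) × EuclideanSpace ℝ (Fin (n - k)),
      graphNbhd L k = W.nbhd := by
  let S := W.toSubmodule
  have hS : Module.finrank ℝ S = k := W.finrank_eq
  have hSo : Module.finrank ℝ Sᗮ = n - k := by
    have h1 := S.finrank_add_finrank_orthogonal
    rw [finrank_euclideanSpace_fin] at h1
    omega
  let e₁ : S ≃L[ℝ] EuclideanSpace ℝ (Fin k) :=
    ContinuousLinearEquiv.ofFinrankEq (by rw [hS, finrank_euclideanSpace_fin])
  let e₂ : Sᗮ ≃L[ℝ] EuclideanSpace ℝ (Fin (n - k)) :=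
    ContinuousLinearEquiv.ofFinrankEq (by rw [hSo, finrank_euclideanSpace_fin])
  let e := S.prodEquivOfIsCompl Sᗮ S.isCompl_orthogonal
  let L : EuclideanSpace ℝ (Fin n) ≃L[ℝ]
      EuclideanSpace ℝ (Fin k) × EuclideanSpace ℝ (Fin (n - k)) :=
    e.symm.toContinuousLinearEquiv.trans (e₁.prodCongr e₂)
  have hL : ∀ x, (L x).1 = e₁ (S.orthogonalProjectionOnto x) := by
    intro x
    obtain ⟨⟨s, t⟩, rfl⟩ := e.surjective x
    change e₁ (e.symm (e (s, t))).1 = e₁ (S.orthogonalProjectionOnto ((s : _) + (t : _)))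
    rw [e.symm_apply_apply, map_add, Submodule.orthogonalProjectionOnto_mem_subspace_eq_self,
      Submodule.orthogonalProjectionOnto_apply_of_mem_orthogonal t.2, add_zero]
  refine ⟨L, Set.ext fun V => ⟨fun hV => Set.Subset.antisymm ?_ fun y hy => ?_, fun hV w => ?_⟩⟩
  · rintro _ ⟨x, -, rfl⟩
    exact Submodule.starProjection_apply_mem _ _
  · obtain ⟨x, hx, hxy⟩ := hV (e₁ ⟨y, hy⟩)
    rw [hL] at hxy
    exact ⟨x, hx, congrArg Subtype.val (e₁.injective hxy)⟩
  · obtain ⟨x, hx, hxw⟩ : ((e₁.symm w : S) : EuclideanSpace ℝ (Fin n)) ∈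
        (fun x => S.starProjection x) '' (V.toSubmodule : Set (EuclideanSpace ℝ (Fin n))) := by
      rw [show _ = _ from hV]
      exact (e₁.symm w).2
    refine ⟨x, hx, ?_⟩
    rw [hL, show S.orthogonalProjectionOnto x = e₁.symm w from Subtype.ext hxw, e₁.apply_symm_apply]

end ConvexHyperspace

theorem theorem5p3 (n k : ℕ) (hk : k ≤ n) :
    IsRetraction (Gr.incl : Gr k (EuclideanSpace ℝ (Fin n)) → _)
      (parallelMap : ConvexDim k (EuclideanSpace ℝ (Fin n)) → _) ∧
    (∀ W : Gr k (EuclideanSpace ℝ (Fin n)),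
      Nonempty (((parallelMap : ConvexDim k (EuclideanSpace ℝ (Fin n)) → _) ⁻¹' W.nbhd) ≃ₜ
        W.nbhd × EuclideanSpace ℝ (Fin (n - k)) × ConvexDim k (EuclideanSpace ℝ (Fin k)))) ∧
    IsFiberBundle (EuclideanSpace ℝ (Fin (n - k)) × ConvexDim k (EuclideanSpace ℝ (Fin k)))
      (parallelMap : ConvexDim k (EuclideanSpace ℝ (Fin n)) → _) ∧
    (∀ W : Gr k (EuclideanSpace ℝ (Fin n)),
      Nonempty
        (((parallelMapBounded : BoundedConvexDim k (EuclideanSpace ℝ (Fin n)) → _) ⁻¹' W.nbhd) ≃ₜ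
        W.nbhd × EuclideanSpace ℝ (Fin (n - k)) ×
          BoundedConvexDim k (EuclideanSpace ℝ (Fin k)))) ∧
    IsFiberBundle
      (EuclideanSpace ℝ (Fin (n - k)) × BoundedConvexDim k (EuclideanSpace ℝ (Fin k)))
      (parallelMapBounded : BoundedConvexDim k (EuclideanSpace ℝ (Fin n)) → _) := by
  have hP : Module.finrank ℝ (EuclideanSpace ℝ (Fin k)) = k := finrank_euclideanSpace_fin
  have hopen : ∀ W : Gr k (EuclideanSpace ℝ (Fin n)), IsOpen W.nbhd := fun W => by
    obtain ⟨L, hL⟩ := W.exists_chart hk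
    exact hL ▸ isOpen_graphNbhd L hP
  have hcover : ⋃₀ Set.range (Gr.nbhd : Gr k (EuclideanSpace ℝ (Fin n)) → _) = Set.univ :=
    Set.eq_univ_of_forall fun W => ⟨_, ⟨W, rfl⟩, W.mem_nbhd_self⟩
  have hcont : Continuous (parallelMap : ConvexDim k (EuclideanSpace ℝ (Fin n)) → _) := by
    refine continuous_iff_continuousAt.2 fun A => ?_
    obtain ⟨L, hL⟩ := (parallelMap A).exists_chart hk
    exact continuousAt_parallelMap L hP (hL ▸ (parallelMap A).mem_nbhd_self)
  have htriv : ∀ W : Gr k (EuclideanSpace ℝ (Fin n)),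
      ∃ φ : (W.nbhd × EuclideanSpace ℝ (Fin (n - k)) × ConvexDim k (EuclideanSpace ℝ (Fin k))) ≃ₜ
        ((parallelMap : ConvexDim k (EuclideanSpace ℝ (Fin n)) → _) ⁻¹' W.nbhd),
        ∀ b t, parallelMap (φ (b, t)).1 = b := fun W => by
    obtain ⟨L, hL⟩ := W.exists_chart hk
    exact hL ▸ exists_trivialization_parallelMap L hP
  have htrivb : ∀ W : Gr k (EuclideanSpace ℝ (Fin n)),
      ∃ φ : (W.nbhd × EuclideanSpace ℝ (Fin (n - k)) ×
          BoundedConvexDim k (EuclideanSpace ℝ (Fin k))) ≃ₜ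
        ((parallelMapBounded : BoundedConvexDim k (EuclideanSpace ℝ (Fin n)) → _) ⁻¹' W.nbhd),
        ∀ b t, parallelMapBounded (φ (b, t)).1 = b := fun W => by
    obtain ⟨L, hL⟩ := W.exists_chart hk
    exact hL ▸ exists_trivialization_parallelMapBounded L hP
  refine ⟨⟨⟨Gr.isInducing_incl, Function.LeftInverse.injective parallelMap_incl⟩, hcont,
    parallelMap_incl⟩, fun W => ⟨(htriv W).choose.symm⟩, ⟨hcont, fun V => ⟨_, parallelMap_incl V⟩,
    Set.range Gr.nbhd, ?_, hcover, ?_⟩, fun W => ⟨(htrivb W).choose.symm⟩,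
    ⟨hcont.comp BoundedConvexDim.isEmbedding_incl.continuous, fun V => ?_,
    Set.range Gr.nbhd, ?_, hcover, ?_⟩⟩
  · rintro _ ⟨W, rfl⟩
    exact hopen W
  · rintro _ ⟨W, rfl⟩
    exact htriv W
  · obtain ⟨L, hL⟩ := V.exists_chart hk
    exact exists_parallelMapBounded_eq L hP (hL ▸ V.mem_nbhd_self)
  · rintro _ ⟨W, rfl⟩
    exact hopen W
  · rintro _ ⟨W, rfl⟩
    exact htrivb W
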